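/- Fix $k\ge 2$. Let $\mathcal L_k$ be the language with a single $2k$-ary relation symbol $E(\bar x,\bar y)$, where $|\bar x|=|\bar y|=k$, and let $\mathsf{Equiv}^0_k$ be the $\mathcal L_k$-theory stating that (i) $E$ is a partial equivalence relation (symmetric and transitive) on $k$-tuples; (ii) $E(\bar x,\bar x)$ holds if and only if $x_i\ne x_j$ for all $i<j<k$; (iii) if $x_i\neq x_j$ for all $i<j<k$, then $E(\bar x,x_{\sigma(0)}\dots x_{\sigma(k-1)})$ holds for every permutation $\sigma$ of $\{0,\dots,k-1\}$. Let $\mathsf{Equiv}_k$ be the theory of the Fraïssé limit of the class of finite models of $\mathsf{Equiv}^0_k$. For $n\ge 1$ and a theory $T$, an $(n+1)$-partitioned formula $\varphi(x;y_1,\dots,y_{n-1};z)$ (each variable being a finite tuple of variables) has $\mathrm{FOP}_n$ in $T$ if in some model of $T$ there are tuples $(a_f)_{f:\omega^{n-1}\to\omega}$, $(b^t_i)_{i<\omega}$ for $1\le t\le n-1$, and $(c_j)_{j<\omega}$ such that, for all $f:\omega^{n-1}\to\omega$ and all $i_1,\dots,i_{n-1},j<\omega$, $\varphi(a_f;b^1_{i_1},\dots,b^{n-1}_{i_{n-1}};c_j)$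 holds if and only if $j\le f(i_1,\dots,i_{n-1})$. The theory $T$ is $\mathrm{NFOP}_n$ if no $(n+1)$-partitioned formula has $\mathrm{FOP}_n$ in $T$. The theory $T$ has $\mathrm{IP}_n$ if there are an $(n+1)$-partitioned formula $\varphi(x;y_1,\dots,y_n)$ and, in some model of $T$, tuples $(b^t_i)_{i<\omega}$ for $1\le t\le n$ such that for every $X\subseteq\omega^n$ there is a tuple $a$ with the property that, for all $i_1,\dots,i_n<\omega$, $\varphi(a;b^1_{i_1},\dots,b^n_{i_n})$ holds if and only if $(i_1,\dots,i_n)\in X$. Then $\mathsf{Equiv}_k$ is $\mathrm{NFOP}_k$ and has $\mathrm{IP}_{k-1}$. -/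

import Mathlib

universe u v w

namespace EquivK

open FirstOrder FirstOrder.Language

/-- The relation symbols: a single symbol of arity `k + k`. -/
inductive Rel (k : ℕ) : ℕ → Type
  | E : Rel k (k + k)

/-- The relational language with one `2k`-ary relation symbol `E`. -/
def lang (k : ℕ) : FirstOrder.Language.{0, 0} where
  Functions := fun _ => Empty
  Relations := Rel k

instance (k n : ℕ) : IsEmpty ((lang k).Functions n) :=
  inferInstanceAs (IsEmpty Empty)

/-- The atomic formula `E(x̄, ȳ)`. -/
def eqv {k : ℕ} {α : Type} (x y : Fin k → α) : (lang k).Formula α :=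
  Relations.formula (L := lang k) (n := k + k) Rel.E fun i => Term.var (Fin.append x y i)

/-- The relation `E(a, b)` on `k`-tuples of elements of a structure. -/
def Holds {k : ℕ} {M : Type w} [(lang k).Structure M] (a b : Fin k → M) : Prop :=
  Structure.RelMap (L := lang k) (n := k + k) Rel.E (Fin.append a b)

/-- The formula saying that `x_i ≠ x_j` for all `i < j < k`. -/
noncomputable def distinct {k : ℕ} {α : Type} (x : Fin k → α) : (lang k).Formula α :=
  Formula.iInf fun p : {p : Fin k × Fin k // p.1 < p.2} =>
    ∼(Term.equal (Term.var (x p.1.1)) (Term.var (x p.1.2)))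

/-- The universal closure of a formula with free variables indexed by a finite type `β`. -/
noncomputable def univ {k : ℕ} {β : Type} [Finite β] (φ : (lang k).Formula β) :
    (lang k).Sentence :=
  Formula.iAlls β (φ.relabel (Sum.inr : β → Empty ⊕ β))

/-- `E` is symmetric. -/
noncomputable def symmAx (k : ℕ) : (lang k).Sentence :=
  univ (β := Fin 2 × Fin k)
    ((eqv (fun i => (0, i)) (fun i => (1, i))).imp (eqv (fun i => (1, i)) (fun i => (0, i))))

/-- `E` is transitive. -/
noncomputable def transAx (k : ℕ) : (lang k).Sentence :=
  univ (β := Fin 3 × Fin k)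
    ((eqv (fun i => (0, i)) (fun i => (1, i)) ⊓ eqv (fun i => (1, i)) (fun i => (2, i))).imp
      (eqv (fun i => (0, i)) (fun i => (2, i))))

/-- `E(x̄, x̄)` if and only if the entries of `x̄` are pairwise distinct. -/
noncomputable def reflAx (k : ℕ) : (lang k).Sentence :=
  univ (β := Fin k) ((eqv (fun i => i) (fun i => i)).iff (distinct fun i => i))

/-- If the entries of `x̄` are pairwise distinct, then `E(x̄, x_{σ(0)} … x_{σ(k-1)})`. -/
noncomputable def permAx (k : ℕ) (σ : Equiv.Perm (Fin k)) : (lang k).Sentence :=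
  univ (β := Fin k) ((distinct fun i => i).imp (eqv (fun i => i) (fun i => σ i)))

/-- The theory `Equiv⁰_k`. -/
noncomputable def theory₀ (k : ℕ) : (lang k).Theory :=
  {symmAx k, transAx k, reflAx k} ∪ Set.range (permAx k)

/-- The class of finite models of `Equiv⁰_k`. -/
def finiteModels (k : ℕ) : Set (CategoryTheory.Bundled.{0} (lang k).Structure) :=
  {M | Finite M ∧ M ⊨ theory₀ k}

/-- The theory `Equiv_k` of the Fraïssé limit of the class of finite models of `Equiv⁰_k`.
The limit is unique up to isomorphism, so that this is the complete theory of any given limit; see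
`theory_eq_completeTheory` below. -/
def theory (k : ℕ) : (lang k).Theory :=
  {φ | ∀ (M : Type) [(lang k).Structure M] [Countable M],
    IsFraisseLimit (finiteModels k) M → M ⊨ φ}

theorem realize_eqv {k : ℕ} {α : Type} {M : Type w} [(lang k).Structure M] (x y : Fin k → α)
    (v : α → M) :
    (eqv x y).Realize v ↔ Holds (fun i => v (x i)) (fun i => v (y i)) := by
  have h : (fun i => v (Fin.append x y i)) =
      Fin.append (fun i => v (x i)) (fun i => v (y i)) := by
    funext i
    refine Fin.addCases (fun i => ?_) (fun i => ?_) i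
    · rw [Fin.append_left, Fin.append_left]
    · rw [Fin.append_right, Fin.append_right]
  rw [eqv, Holds, ← h]
  exact Formula.realize_rel

theorem realize_distinct {k : ℕ} {α : Type} {M : Type w} [(lang k).Structure M] (x : Fin k → α)
    (v : α → M) :
    (distinct x).Realize v ↔ Function.Injective fun i => v (x i) := by
  simp only [distinct, Formula.realize_iInf, Formula.realize_not, Formula.realize_equal,
    Term.realize_var, Subtype.forall, Prod.forall]
  constructor
  · intro h i j hij
    rcases lt_trichotomy i j with hl | hl | hl
    · exact absurd hij (h i j hl)
    · exact hl
    · exact absurd hij.symm (h j i hl)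
  · intro h i j hl hij
    exact hl.ne (h hij)

theorem realize_univ {k : ℕ} {β : Type} [Finite β] {M : Type w} [(lang k).Structure M]
    (φ : (lang k).Formula β) : M ⊨ univ φ ↔ ∀ v : β → M, φ.Realize v := by
  simp only [univ, Sentence.Realize, Formula.realize_iAlls, Formula.realize_relabel,
    Function.comp_def, Sum.elim_inr]

theorem model_theory₀_iff {k : ℕ} {M : Type w} [(lang k).Structure M] :
    M ⊨ theory₀ k ↔
      (∀ a b : Fin k → M, Holds a b → Holds b a) ∧
      (∀ a b c : Fin k → M, Holds a b → Holds b c → Holds a c) ∧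
      (∀ a : Fin k → M, Holds a a ↔ Function.Injective a) ∧
      (∀ (σ : Equiv.Perm (Fin k)) (a : Fin k → M), Function.Injective a →
        Holds a fun i => a (σ i)) := by
  simp only [theory₀, Theory.model_iff, Set.mem_union, Set.mem_insert_iff,
    Set.mem_singleton_iff, Set.mem_range]
  have hs : M ⊨ symmAx k ↔ ∀ a b : Fin k → M, Holds a b → Holds b a := by
    simp only [symmAx, realize_univ, Formula.realize_imp, realize_eqv]
    exact ⟨fun h a b => by simpa using h fun p => ![a, b] p.1 p.2, fun h v => h _ _⟩
  have ht : M ⊨ transAx k ↔ ∀ a b c : Fin k → M, Holds a b → Holds b c → Holds a c := by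
    simp only [transAx, realize_univ, Formula.realize_imp, Formula.realize_inf, realize_eqv]
    exact ⟨fun h a b c h₁ h₂ => by simpa [h₁, h₂] using h fun p => ![a, b, c] p.1 p.2,
      fun h v hv => h _ _ _ hv.1 hv.2⟩
  have hr : M ⊨ reflAx k ↔ ∀ a : Fin k → M, Holds a a ↔ Function.Injective a := by
    simp only [reflAx, realize_univ, Formula.realize_iff, realize_eqv, realize_distinct]
  have hp (σ : Equiv.Perm (Fin k)) : M ⊨ permAx k σ ↔
      ∀ a : Fin k → M, Function.Injective a → Holds a fun i => a (σ i) := by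
    simp only [permAx, realize_univ, Formula.realize_imp, realize_eqv, realize_distinct]
  rw [← hs, ← ht, ← hr]
  simp only [← hp]
  constructor
  · intro h
    exact ⟨h _ (by simp), h _ (by simp), h _ (by simp), fun σ => h _ (Or.inr ⟨σ, rfl⟩)⟩
  · rintro ⟨h₁, h₂, h₃, h₄⟩ φ ((rfl | rfl | rfl) | ⟨σ, rfl⟩)
    · exact h₁
    · exact h₂
    · exact h₃
    · exact h₄ σ

theorem theory_eq_completeTheory {k : ℕ} (M : Type) [(lang k).Structure M] [Countable M]
    (hM : IsFraisseLimit (finiteModels k) M) : theory k = (lang k).completeTheory M := by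
  ext φ
  refine ⟨fun h => h M hM, fun h N _ _ hN => ?_⟩
  obtain ⟨e⟩ := hM.nonempty_equiv hN
  exact (StrongHomClass.realize_sentence e φ).1 h

end EquivK

namespace HigherArity

open FirstOrder FirstOrder.Language

variable {L : FirstOrder.Language.{u, v}}

/-- The `(k+1)`-partitioned formula `φ(x; y₁, …, y_{k-1}; z)` has `FOP_k` in `T` (`k ≥ 1`): in
some model of `T` there are tuples `a_f` for `f : ω^{k-1} → ω`, tuples `b_t i` for `t < k - 1` and
`i < ω`, and tuples `c j` for `j < ω`, such that `φ(a_f; b₁ i₁, …, b_{k-1} i_{k-1}; c j)` holds if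
and only if `j ≤ f (i₁, …, i_{k-1})`. The variables of `φ` are partitioned into finite tuples of
the lengths `m`, `d t` and `n`. -/
def FormulaFOP (k : ℕ) (T : L.Theory) {m n : ℕ} {d : Fin (k - 1) → ℕ}
    (φ : L.Formula (Fin m ⊕ (Σ t, Fin (d t)) ⊕ Fin n)) : Prop :=
  ∃ (M : Theory.ModelType.{u, v, w} T) (a : ((Fin (k - 1) → ℕ) → ℕ) → Fin m → M)
    (b : ∀ t : Fin (k - 1), ℕ → Fin (d t) → M) (c : ℕ → Fin n → M),
    ∀ (f : (Fin (k - 1) → ℕ) → ℕ) (i : Fin (k - 1) → ℕ) (j : ℕ),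
      φ.Realize (Sum.elim (a f) (Sum.elim (fun s => b s.1 (i s.1) s.2) (c j))) ↔ j ≤ f i

/-- `T` is `NFOP_k` (`k ≥ 1`): no `(k+1)`-partitioned formula has `FOP_k` in `T`. -/
def NFOP (k : ℕ) (T : L.Theory) : Prop :=
  ∀ (m n : ℕ) (d : Fin (k - 1) → ℕ) (φ : L.Formula (Fin m ⊕ (Σ t, Fin (d t)) ⊕ Fin n)),
    ¬ FormulaFOP.{u, v, w} k T φ

/-- The `(k+1)`-partitioned formula `φ(x; y₁, …, y_k)` has the `k`-independence property in `T`
(`k ≥ 1`): in some model of `T` there are tuples `b_t i` for `t < k` and `i < ω` such that for every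
`X ⊆ ω^k` there is a tuple `a` such that `φ(a; b₁ i₁, …, b_k i_k)` holds if and only if
`(i₁, …, i_k) ∈ X`. -/
def FormulaIP (k : ℕ) (T : L.Theory) {m : ℕ} {d : Fin k → ℕ}
    (φ : L.Formula (Fin m ⊕ Σ t, Fin (d t))) : Prop :=
  ∃ (M : Theory.ModelType.{u, v, w} T) (b : ∀ t : Fin k, ℕ → Fin (d t) → M),
    ∀ X : Set (Fin k → ℕ), ∃ a : Fin m → M, ∀ i : Fin k → ℕ,
      φ.Realize (Sum.elim a fun s => b s.1 (i s.1) s.2) ↔ i ∈ X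

/-- `T` has `IP_k` (`k ≥ 1`): some `(k+1)`-partitioned formula has the `k`-independence property
in `T`. -/
def HasIP (k : ℕ) (T : L.Theory) : Prop :=
  ∃ (m : ℕ) (d : Fin k → ℕ) (φ : L.Formula (Fin m ⊕ Σ t, Fin (d t))), FormulaIP.{u, v, w} k T φ

end HigherArity

/-!
The argument rests on an explicit countable model. Colour the finite sets of natural numbers so that
every finitely supported assignment `T ↦ g T` is realised as `T ↦ color (T ∪ {x})` by arbitrarily
large `x`, and let `E` be the equality of colours on the `k`-tuples with distinct entries. A finite
partial embedding of a countable model of `theory₀ k` into this structure extends to any further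
point (`exists_extend`): the colours required of the new `k`-sets form a finitely supported
assignment. Hence the structure is a Fraïssé limit (`isFraisseLimit_generic`) and `theory k` is its
complete theory. Ultrahomogeneity shows that the truth of a formula at a finite tuple is determined
by the atomic formulas true there; for each formula this is a first-order sentence, so it passes to
all models of `theory k` (`realize_iff_of_same_atoms`).

For `NFOP k`, send a `k`-tuple of elements to its `E`-class. The atomic type of a tuple
`(a_f, b₁ i₁, …, b_{k-1} i_{k-1}, c_j)` is read off from the equalities between finitely many values,
each of which is computed from at most `k` of the coordinates, while there are `k + 1` blocks of
variables. So each value ignores `f`, or `j`, or some `i_t`. Such equalities cannot express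
`j ≤ f i` (`exists_same_equalities`). Indeed let `j` and the values of `f` range below a constant `M`
and the `i_t` below a large `N`. The values that ignore some `i_t` are indexed by `O(N ^ (k - 2))`
arguments, so up to equalities among themselves and with the values that ignore `f` they have only
`N ^ O(N ^ (k - 2))` patterns, which is negligible against the ratio of `M ^ N ^ (k - 1)` to
`(M - 1) ^ N ^ (k - 1)`. By counting, there are one pattern and one `i` such that the functions `f`
with this pattern take every value below `M` at `i`. The pattern gives a large set `J` of indices `j`
on which every value that depends on `j` is constant or injective. Choosing `f` with `f i` in the
middle of `J`, the values that ignore `j` meet the injective ones at boundedly many `j ∈ J`. Outside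
these exceptions all `j ∈ J` show the same equalities, on both sides of `f i`.

For `IP_{k-1}`, fix a tuple `z̄`. Every finite part of every `X ⊆ ω^{k-1}` is defined in the explicit
model by `E(x y₁ … y_{k-1}, z̄)` for a suitable `x`, and a nonprincipal ultrapower yields all of `X`.
-/

universe w'

/-! ### Order is not expressible by equalities of functions of fewer arguments -/

namespace HigherArity

section Combinatorics

open Finset

/-- Canonical Ramsey theorem for one function of one variable. -/
theorem exists_constant_or_injOn_subset {P : Type*} (u : ℕ → P) (R : ℕ) (S : Finset ℕ)
    (hS : R * R ≤ #S) :
    ∃ J ⊆ S, R ≤ #J ∧ ((∀ j ∈ J, ∀ j' ∈ J, u j = u j') ∨ Set.InjOn u J) := by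
  classical
  by_cases h : R ≤ #(S.image u)
  · obtain ⟨J, hJS, hinj, hJ⟩ := exists_subset_injOn_image_eq_of_surjOn (f := u) (S : Set ℕ)
      (S.image u) (by simpa using (S : Set ℕ).surjOn_image u)
    refine ⟨J, by exact_mod_cast hJS, ?_, Or.inr hinj⟩
    rw [← hJ] at h
    exact h.trans card_image_le
  · push Not at h
    rcases R.eq_zero_or_pos with rfl | hR
    · omega
    have hne : S.Nonempty := card_pos.1 (lt_of_lt_of_le (Nat.mul_pos hR hR) hS)
    obtain ⟨y, -, hy⟩ := exists_le_card_fiber_of_mul_le_card_of_maps_to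
      (fun a ha => mem_image_of_mem u ha) (hne.image u) ((Nat.mul_le_mul_right R h.le).trans hS)
    refine ⟨_, filter_subset _ _, hy, Or.inl fun j hj j' hj' => ?_⟩
    simp only [mem_filter] at hj hj'
    rw [hj.2, hj'.2]

/-- A finite family of functions on a long enough initial segment of `ℕ` is simultaneously
homogeneous on a large set: each member is constant or injective there, and the equalities between
values at the same point do not depend on the point. -/
theorem exists_homogeneous_subset {D P : Type*} [Finite D] (R : ℕ) :
    ∃ M : ℕ, ∀ u : D → ℕ → P, ∃ J ⊆ range M, R ≤ #J ∧
      (∀ d, (∀ j ∈ J, ∀ j' ∈ J, u d j = u d j') ∨ Set.InjOn (u d) J) ∧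
      ∀ j ∈ J, ∀ j' ∈ J, ∀ d d', u d j = u d' j ↔ u d j' = u d' j' := by
  classical
  have := Fintype.ofFinite D
  have step : ∀ (T : Finset D) (R : ℕ), ∃ M : ℕ, ∀ (u : D → ℕ → P) (S : Finset ℕ), M ≤ #S →
      ∃ J ⊆ S, R ≤ #J ∧ ∀ d ∈ T, (∀ j ∈ J, ∀ j' ∈ J, u d j = u d j') ∨ Set.InjOn (u d) J := by
    intro T
    induction T using Finset.induction_on with
    | empty => exact fun R => ⟨R, fun u S hS => ⟨S, subset_rfl, hS, by simp⟩⟩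
    | insert d T _ ih =>
      intro R
      obtain ⟨M, hM⟩ := ih (R * R)
      refine ⟨M, fun u S hS => ?_⟩
      obtain ⟨J, hJS, hJR, hJ⟩ := hM u S hS
      obtain ⟨J', hJ'J, hJ'R, hJ'⟩ := exists_constant_or_injOn_subset (u d) R J hJR
      refine ⟨J', hJ'J.trans hJS, hJ'R, fun e he => ?_⟩
      rcases mem_insert.1 he with rfl | he
      · exact hJ'
      · exact (hJ e he).imp (fun h j hj j' hj' => h j (hJ'J hj) j' (hJ'J hj'))
          fun h => h.mono (by exact_mod_cast hJ'J)
  obtain ⟨M, hM⟩ := step univ R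
  refine ⟨Fintype.card (D → D → Prop) * M, fun u => ?_⟩
  obtain ⟨y, hy⟩ : ∃ y : D → D → Prop, M ≤
      #{j ∈ range (Fintype.card (D → D → Prop) * M) | (fun d d' => u d j = u d' j) = y} := by
    obtain ⟨y, -, hy⟩ := exists_le_card_fiber_of_mul_le_card_of_maps_to
      (s := range (Fintype.card (D → D → Prop) * M)) (t := univ)
      (f := fun j d d' => u d j = u d' j) (n := M) (fun _ _ => mem_univ _) univ_nonempty
      (by simp [-Fintype.card_pi])
    exact ⟨y, hy⟩
  obtain ⟨J, hJS, hJR, hJ⟩ := hM u _ hy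
  refine ⟨J, hJS.trans (filter_subset _ _), hJR, fun d => hJ d (mem_univ d), ?_⟩
  intro j hj j' hj' d d'
  have h1 := (mem_filter.1 (hJS hj)).2
  have h2 := (mem_filter.1 (hJS hj')).2
  exact iff_of_eq (congrFun (congrFun (h1.trans h2.symm) d) d')

/-- If `code` has few values, then on some fibre of `code` some coordinate takes all values:
otherwise each fibre avoids one value in each coordinate and has at most `(M - 1) ^ |X|` members. -/
theorem exists_fiber_surjective {X C : Type*} [Fintype X] [Fintype C] [Nonempty C] {M : ℕ}
    (code : (X → Fin M) → C)
    (h : Fintype.card C * (M - 1) ^ Fintype.card X < M ^ Fintype.card X) :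
    ∃ (g : C) (x : X), ∀ m, ∃ f, code f = g ∧ f x = m := by
  classical
  by_contra! hcon
  choose m hm using hcon
  have := Finset.card_le_mul_card_image (s := (univ : Finset (X → Fin M))) (f := code)
    ((M - 1) ^ Fintype.card X) (fun g _ => by
      refine (card_le_card (t := Fintype.piFinset fun x => univ.erase (m g x)) ?_).trans ?_
      · intro f hf
        simp only [mem_filter] at hf
        simpa using fun x => hm g x f hf.2
      · simp)
  have h2 : #(univ.image code) ≤ Fintype.card C := card_le_univ _
  have h3 : #(univ : Finset (X → Fin M)) = M ^ Fintype.card X := by simp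
  rw [h3] at this
  have := this.trans (Nat.mul_le_mul_left _ h2)
  rw [mul_comm] at this
  omega

/-- The equalities among the values of `G : V → P`, and between these and the values of a fixed
`h : W → P`, can be coded by a function from `V` to `W ⊕ V`. This bounds the number of patterns. -/
theorem exists_code {V W P : Type*} (h : W → P) :
    ∃ code : (V → P) → V → W ⊕ V, ∀ G G', code G = code G' →
      (∀ v v', G v = G v' ↔ G' v = G' v') ∧ ∀ v w, G v = h w ↔ G' v = h w := by
  classical
  rcases isEmpty_or_nonempty V with _ | _
  · exact ⟨fun _ v => isEmptyElim v, fun _ _ _ => ⟨fun v => isEmptyElim v, fun v => isEmptyElim v⟩⟩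
  -- A value of `G` in the range of `h` is coded by an argument of `h`, any other value by an argument
  -- of `G` that depends only on the value.
  let code : (V → P) → V → W ⊕ V := fun G v =>
    if hw : ∃ w, h w = G v then Sum.inl hw.choose else Sum.inr (Function.invFun G (G v))
  have hl : ∀ G v w, code G v = Sum.inl w → G v = h w := by
    intro G v w e
    simp only [code] at e
    split_ifs at e with hw
    rw [← Sum.inl.inj e, hw.choose_spec]
  have hr : ∀ G v w, code G v = Sum.inr w → G v = G w := by
    intro G v w e
    simp only [code] at e
    split_ifs at e with hw
    rw [← Sum.inr.inj e, Function.invFun_eq (f := G) ⟨v, rfl⟩]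
  have key : ∀ G v v', code G v = code G v' ↔ G v = G v' := by
    refine fun G v v' => ⟨fun e => ?_, fun e => by simp only [code, e]⟩
    rcases hc : code G v' with w | w
    · rw [hl G v w (e.trans hc), hl G v' w hc]
    · rw [hr G v w (e.trans hc), hr G v' w hc]
  have key2 : ∀ G v w, G v = h w ↔ ∃ w', code G v = Sum.inl w' ∧ h w' = h w := by
    refine fun G v w => ⟨fun e => ?_, fun ⟨w', e, e'⟩ => (hl G v w' e).trans e'⟩
    have hw : ∃ w, h w = G v := ⟨w, e.symm⟩
    exact ⟨hw.choose, by simp only [code, dif_pos hw], hw.choose_spec.trans e⟩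
  exact ⟨code, fun G G' e => ⟨fun v v' => by rw [← key, ← key, e],
    fun v w => by rw [key2, key2, e]⟩⟩

/-- The inequality that makes the count of patterns negligible, before raising both sides to the
power `N ^ n`. -/
theorem exists_pow_mul_pow_lt (A B n : ℕ) {M : ℕ} (hM : 2 ≤ M) :
    ∃ N : ℕ, 0 < N ∧ (A * N ^ (n + 1)) ^ B * (M - 1) ^ N < M ^ N := by
  obtain ⟨m, rfl⟩ : ∃ m, M = m + 1 := ⟨M - 1, by omega⟩
  have hm : (0 : ℝ) < m := by exact_mod_cast (by omega : 0 < m)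
  have hr : (1 : ℝ) < (m + 1) / m := by rw [lt_div_iff₀ hm]; linarith
  have h0 := (tendsto_pow_const_div_const_pow_of_one_lt ((n + 1) * B) hr).const_mul ((A : ℝ) ^ B)
  rw [mul_zero] at h0
  obtain ⟨N, hN, hN0⟩ := ((h0.eventually_lt_const zero_lt_one).and
    (Filter.eventually_gt_atTop 0)).exists
  refine ⟨N, hN0, ?_⟩
  rw [div_pow, div_div_eq_mul_div, ← mul_div_assoc, div_lt_one (by positivity)] at hN
  have : ((A : ℝ) * N ^ (n + 1)) ^ B * m ^ N < (m + 1) ^ N := by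
    rw [mul_pow, ← pow_mul]; linarith
  exact_mod_cast this

theorem exists_middle (J : Finset ℕ) (q : ℕ) (h : 2 * (q + 1) ≤ #J) :
    ∃ m ∈ J, q < #{j ∈ J | j ≤ m} ∧ q < #{j ∈ J | m < j} := by
  let e := J.orderEmbOfFin rfl
  have hq : q < #J := by omega
  refine ⟨e ⟨q, hq⟩, J.orderEmbOfFin_mem rfl _, ?_, ?_⟩
  · have : (Iic (⟨q, hq⟩ : Fin #J)).map e.toEmbedding ⊆ {j ∈ J | j ≤ e ⟨q, hq⟩} := by
      intro j hj
      simp only [mem_map, mem_Iic] at hj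
      obtain ⟨i, hi, rfl⟩ := hj
      simpa [e] using hi
    have := card_le_card this
    simp at this
    omega
  · have : (Ioi (⟨q, hq⟩ : Fin #J)).map e.toEmbedding ⊆ {j ∈ J | e ⟨q, hq⟩ < j} := by
      intro j hj
      simp only [mem_map, mem_Ioi] at hj
      obtain ⟨i, hi, rfl⟩ := hj
      simpa [e] using hi
    have := card_le_card this
    simp at this
    omega

/-- Functional order cannot be coded by equalities between quantities each of which ignores one of
the arguments `f`, `i t`, `j`. -/
theorem exists_same_equalities {n : ℕ} {D P : Type*} [Finite D]
    (val : ((Fin (n + 1) → ℕ) → ℕ) → (Fin (n + 1) → ℕ) → ℕ → D → P)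
    (hval : ∀ d, (∀ f f' i j, val f i j d = val f' i j d) ∨
      (∀ f i j j', val f i j d = val f i j' d) ∨
      ∃ t, ∀ f i i' j, (∀ s, s ≠ t → i s = i' s) → val f i j d = val f i' j d) :
    ∃ f i j j', j ≤ f i ∧ f i < j' ∧
      ∀ d d', val f i j d = val f i j d' ↔ val f i j' d = val f i j' d' := by
  classical
  have := Fintype.ofFinite D
  have hval' : ∀ d, ∃ t, (∀ f f' i j, val f i j d = val f' i j d) ∨
      (∀ f i j j', val f i j d = val f i j' d) ∨
      ∀ f i i' j, (∀ s, s ≠ t → i s = i' s) → val f i j d = val f i' j d := by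
    intro d
    rcases hval d with h | h | ⟨t, h⟩
    · exact ⟨0, Or.inl h⟩
    · exact ⟨0, Or.inr (Or.inl h)⟩
    · exact ⟨t, Or.inr (Or.inr h)⟩
  choose t ht using hval'
  -- `Cc d` says that the `d`-th value ignores `j`.
  let Cc : D → Prop := fun d => ∀ f i j j', val f i j d = val f i j' d
  let q := Fintype.card D * Fintype.card D
  obtain ⟨M, hM⟩ := exists_homogeneous_subset (D := {d // ¬ Cc d}) (P := P) (2 * (q + 1))
  have hM2 : 2 ≤ M := by
    obtain ⟨J, hJM, hJ, -⟩ := hM fun d j => val (fun _ => 0) (fun _ => 0) j d.1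
    have := card_le_card hJM
    rw [card_range] at this
    omega
  obtain ⟨N, hN0, hN⟩ := exists_pow_mul_pow_lt (2 * Fintype.card D * M) (Fintype.card D * M) n hM2
  have : NeZero N := ⟨hN0.ne'⟩
  -- `ext f` extends `f` from the finite box to all of `ℕ ^ (n + 1)`, by reduction modulo `N`.
  let ext : ((Fin (n + 1) → Fin N) → Fin M) → (Fin (n + 1) → ℕ) → ℕ :=
    fun f i => f fun s => Fin.ofNat N (i s)
  have hext : ∀ f x, ext f (fun s => (x s : ℕ)) = f x := by
    intro f x
    simp [ext]
  -- `hW` lists the values that ignore `f`, and `G f` those that ignore the coordinate `t d`, which is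
  -- replaced by `0`. The entries at other `d` are irrelevant.
  let hW : D × Fin M × (Fin (n + 1) → Fin N) → P :=
    fun w => val (fun _ => 0) (fun s => w.2.2 s) w.2.1 w.1
  let G : ((Fin (n + 1) → Fin N) → Fin M) → D × Fin M × (Fin n → Fin N) → P :=
    fun f v => val (ext f) (fun s => ((t v.1).insertNth 0 v.2.2 : Fin (n + 1) → Fin N) s) v.2.1 v.1
  obtain ⟨code, hcode⟩ := exists_code (V := D × Fin M × (Fin n → Fin N)) hW
  have hC : Nonempty (D × Fin M × (Fin n → Fin N) →
      (D × Fin M × (Fin (n + 1) → Fin N)) ⊕ (D × Fin M × (Fin n → Fin N))) := ⟨Sum.inr⟩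
  obtain ⟨g, x, hgx⟩ := exists_fiber_surjective (M := M) (fun f => code (G f)) (by
    simp only [Fintype.card_fun, Fintype.card_sum, Fintype.card_prod, Fintype.card_fin]
    set d := Fintype.card D
    have h1 : d * (M * N ^ (n + 1)) + d * (M * N ^ n) ≤ 2 * d * M * N ^ (n + 1) := by
      have : N ^ n ≤ N ^ (n + 1) := Nat.pow_le_pow_right hN0 (Nat.le_succ n)
      nlinarith [Nat.mul_le_mul_left (d * M) this]
    calc _ ≤ (2 * d * M * N ^ (n + 1)) ^ (d * (M * N ^ n)) * (M - 1) ^ N ^ (n + 1) :=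
          Nat.mul_le_mul_right _ (Nat.pow_le_pow_left h1 _)
      _ = ((2 * d * M * N ^ (n + 1)) ^ (d * M) * (M - 1) ^ N) ^ N ^ n := by
          rw [mul_pow (_ ^ (d * M)), ← pow_mul, ← pow_mul, mul_assoc d, pow_succ' N n]
      _ < (M ^ N) ^ N ^ n := Nat.pow_lt_pow_left hN (pow_pos hN0 n).ne'
      _ = M ^ N ^ (n + 1) := by rw [← pow_mul, pow_succ' N n])
  have hrep : ∀ d (j : Fin M), ¬ Cc d → (∃ w, ∀ f, val (ext f) (fun s => x s) j d = hW w) ∨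
      ∃ v, ∀ f, val (ext f) (fun s => x s) j d = G f v := by
    intro d j hd
    rcases ht d with h | h | h
    · exact Or.inl ⟨(d, j, x), fun f => h _ _ _ _⟩
    · exact absurd h hd
    · refine Or.inr ⟨(d, j, (t d).removeNth x), fun f => h _ _ _ _ fun s hs => ?_⟩
      obtain ⟨r, rfl⟩ := Fin.exists_succAbove_eq hs
      simp [Fin.removeNth]
  have hsame : ∀ f f', code (G f) = code (G f') → ∀ d d' (j j' : Fin M), ¬ Cc d → ¬ Cc d' →
      (val (ext f) (fun s => x s) j d = val (ext f) (fun s => x s) j' d' ↔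
        val (ext f') (fun s => x s) j d = val (ext f') (fun s => x s) j' d') := by
    intro f f' hff d d' j j' hd hd'
    obtain ⟨hGG, hGH⟩ := hcode _ _ hff
    rcases hrep d j hd with ⟨w, hw⟩ | ⟨v, hv⟩ <;> rcases hrep d' j' hd' with ⟨w', hw'⟩ | ⟨v', hv'⟩
    · rw [hw, hw', hw, hw']
    · rw [hw, hv', hw, hv', eq_comm, hGH, eq_comm]
    · rw [hv, hw', hv, hw', hGH]
    · rw [hv, hv', hv, hv', hGG]
  obtain ⟨f₀, hf₀, -⟩ := hgx ⟨0, by omega⟩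
  obtain ⟨J, hJM, hJ, hconst, hpat⟩ := hM fun d j => val (ext f₀) (fun s => x s) j d.1
  obtain ⟨m, hmJ, hlo, hhi⟩ := exists_middle J q hJ
  have hlt : ∀ j ∈ J, j < M := fun j hj => mem_range.1 (hJM hj)
  obtain ⟨f, hf, hfm⟩ := hgx ⟨m, hlt m hmJ⟩
  let u : ℕ → D → P := fun j d => val (ext f) (fun s => x s) j d
  have htr : ∀ d d' j j', j ∈ J → j' ∈ J → ¬ Cc d → ¬ Cc d' →
      (u j d = u j' d' ↔ val (ext f₀) (fun s => x s) j d = val (ext f₀) (fun s => x s) j' d') :=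
    fun d d' j j' hj hj' hd hd' =>
      hsame f f₀ (hf.trans hf₀.symm) d d' ⟨j, hlt j hj⟩ ⟨j', hlt j' hj'⟩ hd hd'
  -- `I d` says that the `d`-th value is injective in `j ∈ J`; otherwise it is constant there.
  let I : D → Prop := fun d => ¬ Cc d ∧ Set.InjOn (fun j => u j d) J
  have hCI : ∀ d, ¬ I d → ∀ j ∈ J, ∀ j' ∈ J, u j d = u j' d := by
    intro d hd j hj j' hj'
    by_cases hc : Cc d
    · exact hc _ _ _ _
    · rcases hconst ⟨d, hc⟩ with h | h
      · exact (htr d d j j' hj hj' hc hc).2 (h j hj j' hj')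
      · exact absurd ⟨hc, fun j hj j' hj' e => h hj hj' ((htr d d j j' hj hj' hc hc).1 e)⟩ hd
  -- Each value ignoring `j` equals a given injective one at most once on `J`.
  let bad : Finset ℕ := univ.biUnion fun p : D × D =>
    {j ∈ J | Cc p.1 ∧ I p.2 ∧ u j p.2 = u j p.1}
  have hbad : #bad ≤ q := by
    refine (card_biUnion_le_card_mul _ _ 1 fun p _ => card_le_one.2 fun j hj j' hj' => ?_).trans
      (by simp [q])
    simp only [mem_filter] at hj hj'
    refine hj.2.2.1.2 hj.1 hj'.1 ?_
    simp only
    rw [hj.2.2.2, hj'.2.2.2]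
    exact hj.2.1 _ _ _ _
  obtain ⟨j, hj, hjb⟩ := exists_mem_notMem_of_card_lt_card (hbad.trans_lt hlo)
  obtain ⟨j', hj', hjb'⟩ := exists_mem_notMem_of_card_lt_card (hbad.trans_lt hhi)
  simp only [mem_filter] at hj hj'
  have hmix : ∀ d d', Cc d → (u j d' = u j d ↔ u j' d' = u j' d) := by
    intro d d' hd
    have e : u j d = u j' d := hd _ _ _ _
    by_cases hi : I d'
    · refine iff_of_false (fun h => hjb ?_) (fun h => hjb' ?_)
      · exact mem_biUnion.2 ⟨(d, d'), mem_univ _, mem_filter.2 ⟨hj.1, hd, hi, h⟩⟩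
      · exact mem_biUnion.2 ⟨(d, d'), mem_univ _, mem_filter.2 ⟨hj'.1, hd, hi, h⟩⟩
    · rw [e, hCI d' hi j hj.1 j' hj'.1]
  refine ⟨ext f, fun s => x s, j, j', ?_, ?_, fun d d' => ?_⟩
  · rw [hext, hfm]; exact hj.2
  · rw [hext, hfm]; exact hj'.2
  · change u j d = u j d' ↔ u j' d = u j' d'
    by_cases hd : Cc d
    · rw [eq_comm, hmix d d' hd, eq_comm]
    by_cases hd' : Cc d'
    · exact hmix d' d hd'
    rw [htr d d' j j hj.1 hj.1 hd hd', htr d d' j' j' hj'.1 hj'.1 hd hd']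
    exact hpat j hj.1 j' hj'.1 ⟨d, hd⟩ ⟨d', hd'⟩

end Combinatorics

end HigherArity

/-! ### Models of `theory₀ k` -/

namespace EquivK

open FirstOrder FirstOrder.Language

theorem comp_append {m n : ℕ} {A B : Type*} (f : A → B) (a : Fin m → A) (b : Fin n → A) :
    f ∘ Fin.append a b = Fin.append (f ∘ a) (f ∘ b) := by
  funext i
  refine Fin.addCases (fun i => ?_) (fun i => ?_) i <;> simp

theorem holds_comp_embedding {k : ℕ} {A B : Type*} [(lang k).Structure A] [(lang k).Structure B]
    (g : A ↪[lang k] B) (a b : Fin k → A) : Holds (g ∘ a) (g ∘ b) ↔ Holds a b := by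
  rw [Holds, Holds, ← comp_append]
  exact g.map_rel _ _

/-- A map that is injective on `S` and preserves `E` there in both directions restricts to an
embedding of `S`. -/
theorem exists_embedding_of_holds_iff {k : ℕ} {A B : Type*} [(lang k).Structure A]
    [(lang k).Structure B] (S : (lang k).Substructure A) (F : A → B) (hinj : Set.InjOn F S)
    (hF : ∀ a b : Fin k → A, (∀ i, a i ∈ S) → (∀ i, b i ∈ S) →
      (Holds (F ∘ a) (F ∘ b) ↔ Holds a b)) :
    ∃ g : S ↪[lang k] B, ∀ s : S, g s = F s := by
  refine ⟨⟨⟨fun s => F s, fun s s' h => Subtype.ext (hinj s.2 s'.2 h)⟩, ?_, ?_⟩, fun s => rfl⟩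
  · intro n f
    exact isEmptyElim f
  · intro n r x
    cases r with
    | E =>
      have hx : x = Fin.append (fun i => x (Fin.castAdd k i)) (fun i => x (Fin.natAdd k i)) :=
        (Fin.append_castAdd_natAdd (f := x)).symm
      rw [hx]
      change Structure.RelMap _ ((fun s : S => F s) ∘ _) ↔ _
      rw [comp_append]
      refine (hF (fun i => x (Fin.castAdd k i)) (fun i => x (Fin.natAdd k i))
        (fun i => (x _).2) fun i => (x _).2).trans ?_
      exact holds_comp_embedding S.subtype _ _

theorem injective_left_of_holds {k : ℕ} {A : Type*} [(lang k).Structure A] (hA : A ⊨ theory₀ k)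
    {a b : Fin k → A} (h : Holds a b) : Function.Injective a := by
  obtain ⟨h1, h2, h3, -⟩ := model_theory₀_iff.1 hA
  exact (h3 a).1 (h2 _ _ _ h (h1 _ _ h))

/-- On models of `theory₀ k`, `E` is the equality of `E`-classes of tuples with distinct entries. The
class of a tuple with a repeated entry is empty. -/
theorem holds_iff {k : ℕ} {A : Type*} [(lang k).Structure A] (hA : A ⊨ theory₀ k)
    {a b : Fin k → A} : Holds a b ↔ Function.Injective a ∧ Function.Injective b ∧
      {c | Holds a c} = {c | Holds b c} := by
  obtain ⟨h1, h2, h3, -⟩ := model_theory₀_iff.1 hA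
  constructor
  · intro h
    exact ⟨injective_left_of_holds hA h, injective_left_of_holds hA (h1 _ _ h),
      Set.ext fun c => ⟨fun hc => h2 _ _ _ (h1 _ _ h) hc, fun hc => h2 _ _ _ h hc⟩⟩
  · rintro ⟨-, hb, h⟩
    have : b ∈ {c | Holds b c} := (h3 b).2 hb
    rwa [← h] at this

/-- The `E`-class of a tuple depends only on the set of its entries. -/
theorem holds_of_range_eq {k : ℕ} {A : Type*} [(lang k).Structure A] (hA : A ⊨ theory₀ k)
    {a b : Fin k → A} (ha : Function.Injective a) (hb : Function.Injective b)
    (h : Set.range a = Set.range b) : Holds a b := by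
  have : ∀ i, ∃ j, a j = b i := fun i => by
    have : b i ∈ Set.range a := h ▸ Set.mem_range_self i
    exact this
  choose σ hσ using this
  have hσi : Function.Injective σ := fun i j e => hb (by rw [← hσ, ← hσ, e])
  have := (model_theory₀_iff.1 hA).2.2.2
    (Equiv.ofBijective σ (Finite.injective_iff_bijective.1 hσi)) a ha
  simpa [hσ] using this

/-! ### A generic colouring of the finite sets of natural numbers -/

/-- An enumeration of the finitely supported functions on finite sets of natural numbers. -/
noncomputable def enum : ℕ → Finset ℕ →₀ ℕ :=
  (exists_surjective_nat (Finset ℕ →₀ ℕ)).choose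

/-- The colour of a finite set of natural numbers: its largest element codes a finitely supported
function, which is evaluated at the set of the other elements. The second component of the pairing
holds the code, so that each function has arbitrarily large codes. -/
noncomputable def color (S : Finset ℕ) : ℕ :=
  enum (S.sup id).unpair.2 (S.erase (S.sup id))

/-- Genericity of the colouring. -/
theorem exists_color_insert_eq (B : ℕ) (g : Finset ℕ →₀ ℕ) :
    ∃ x, B < x ∧ ∀ T : Finset ℕ, (∀ y ∈ T, y < x) → color (insert x T) = g T := by
  obtain ⟨i, hi⟩ := (exists_surjective_nat (Finset ℕ →₀ ℕ)).choose_spec g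
  refine ⟨Nat.pair (B + 1) i, Nat.left_le_pair (B + 1) i, fun T hT => ?_⟩
  have hs : (insert (Nat.pair (B + 1) i) T).sup id = Nat.pair (B + 1) i := by
    rw [Finset.sup_insert, id, sup_eq_left]
    exact Finset.sup_le fun y hy => (hT y hy).le
  have hn : Nat.pair (B + 1) i ∉ T := fun h => (hT _ h).false
  rw [color, hs, Nat.unpair_pair, Finset.erase_insert hn, enum, hi]

/-- The carrier of the generic model of `theory₀ k`: the natural numbers, with the structure given
by `color`. -/
abbrev Generic (_ : ℕ) : Type := ℕ

/-- The colour of the set of entries of a tuple. -/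
noncomputable def Generic.color {k : ℕ} (a : Fin k → Generic k) : ℕ :=
  EquivK.color (Finset.univ.image a)

/-- Two `k`-tuples are `E`-related when both have distinct entries and their colours agree. -/
noncomputable instance (k : ℕ) : (lang k).Structure (Generic k) where
  funMap := fun f => isEmptyElim f
  RelMap := fun {_} r => match r with
    | .E => fun v =>
      Function.Injective (fun i => v (Fin.castAdd k i)) ∧
      Function.Injective (fun i => v (Fin.natAdd k i)) ∧
      Generic.color (fun i => v (Fin.castAdd k i)) = Generic.color (fun i => v (Fin.natAdd k i))

theorem Generic.holds_iff {k : ℕ} {a b : Fin k → Generic k} :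
    Holds a b ↔ Function.Injective a ∧ Function.Injective b ∧
      Generic.color a = Generic.color b := by
  change _ ∧ _ ∧ _ ↔ _
  simp only [Fin.append_left, Fin.append_right]

theorem Generic.model (k : ℕ) : Generic k ⊨ theory₀ k := by
  refine model_theory₀_iff.2 ⟨fun a b h => ?_, fun a b c h h' => ?_, fun a => ?_, fun σ a ha => ?_⟩
  · rw [Generic.holds_iff] at h ⊢
    exact ⟨h.2.1, h.1, h.2.2.symm⟩
  · rw [Generic.holds_iff] at h h' ⊢
    exact ⟨h.1, h'.2.1, h.2.2.trans h'.2.2⟩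
  · simp [Generic.holds_iff]
  · refine Generic.holds_iff.2 ⟨ha, ha.comp σ.injective, ?_⟩
    rw [Generic.color, Generic.color]
    refine congrArg EquivK.color (Finset.ext fun y => ?_)
    simp only [Finset.mem_image, Finset.mem_univ, true_and]
    exact ⟨fun ⟨i, hi⟩ => ⟨σ.symm i, by simpa using hi⟩, fun ⟨i, hi⟩ => ⟨σ i, hi⟩⟩

/-- One-point extension: a finite partial embedding of a countable model of `theory₀ k` into
`Generic k` extends to one more point. -/
theorem exists_extend {k : ℕ} {A : Type*} [Countable A] [(lang k).Structure A]
    (hA : A ⊨ theory₀ k) (S : Set A) (hS : S.Finite) (f : A → Generic k) (hf : Set.InjOn f S)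
    (hfE : ∀ a b : Fin k → A, (∀ i, a i ∈ S) → (∀ i, b i ∈ S) →
      (Holds (f ∘ a) (f ∘ b) ↔ Holds a b)) (m : A) (hm : m ∉ S) :
    ∃ f' : A → Generic k, Set.EqOn f f' S ∧ Set.InjOn f' (insert m S) ∧
      ∀ a b : Fin k → A, (∀ i, a i ∈ insert m S) → (∀ i, b i ∈ insert m S) →
      (Holds (f' ∘ a) (f' ∘ b) ↔ Holds a b) := by
  classical
  obtain ⟨hsymm, htrans, hrefl, -⟩ := model_theory₀_iff.1 hA
  let F : Finset ℕ := hS.toFinset.image f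
  have hFmem : ∀ s ∈ S, (f s : ℕ) ∈ F := fun s hs =>
    Finset.mem_image_of_mem _ (hS.mem_toFinset.2 hs)
  obtain ⟨L, hL⟩ : ∃ L, ∀ T ⊆ F, color T < L :=
    ⟨(F.powerset.sup color) + 1, fun T hT =>
      Nat.lt_succ_of_le (Finset.le_sup (f := color) (Finset.mem_powerset.2 hT))⟩
  have hLS : ∀ s : Fin k → A, (∀ i, s i ∈ S) → Generic.color (f ∘ s) < L := fun s hs =>
    hL _ (by
      intro y hy
      obtain ⟨i, -, rfl⟩ := Finset.mem_image.1 hy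
      exact hFmem _ (hs i))
  have hinjS : ∀ s : Fin k → A, (∀ i, s i ∈ S) → Function.Injective s →
      Function.Injective (f ∘ s) := fun s hs hi i j e => hi (hf (hs i) (hs j) e)
  have hcolS : ∀ s s' : Fin k → A, (∀ i, s i ∈ S) → (∀ i, s' i ∈ S) → Function.Injective s →
      Function.Injective s' → (Generic.color (f ∘ s) = Generic.color (f ∘ s') ↔ Holds s s') := by
    intro s s' hs hs' hi hi'
    rw [← hfE s s' hs hs', Generic.holds_iff]
    simp [hinjS s hs hi, hinjS s' hs' hi']
  obtain ⟨code, hcode⟩ : ∃ code : (Fin k → A) → ℕ,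
      ∀ a b, code a = code b ↔ {c | Holds a c} = {c | Holds b c} := by
    have : Countable (Set.range fun a : Fin k → A => {c | Holds a c}) :=
      (Set.countable_range _).to_subtype
    obtain ⟨e, he⟩ := exists_injective_nat (Set.range fun a : Fin k → A => {c | Holds a c})
    exact ⟨fun a => e ⟨_, a, rfl⟩, fun a b => he.eq_iff.trans Subtype.mk_eq_mk⟩
  -- `κ` prescribes colours on `A`: a class that meets `S` keeps the colour it has under `f`, and the
  -- other classes receive distinct colours from `L` on, which are not used on `F`.
  let κ : (Fin k → A) → ℕ := fun a =>
    if h : ∃ s : Fin k → A, (∀ i, s i ∈ S) ∧ Holds a s then Generic.color (f ∘ h.choose)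
    else L + code a
  have hκyes : ∀ a s : Fin k → A, (∀ i, s i ∈ S) → Holds a s →
      κ a = Generic.color (f ∘ s) := by
    intro a s hs has
    have h : ∃ s : Fin k → A, (∀ i, s i ∈ S) ∧ Holds a s := ⟨s, hs, has⟩
    have h' := h.choose_spec
    simp only [κ, dif_pos h]
    exact (hcolS _ _ h'.1 hs (injective_left_of_holds hA (hsymm _ _ h'.2))
      (injective_left_of_holds hA (hsymm _ _ has))).2 (htrans _ _ _ (hsymm _ _ h'.2) has)
  have hκno : ∀ a, (¬ ∃ s : Fin k → A, (∀ i, s i ∈ S) ∧ Holds a s) → κ a = L + code a :=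
    fun a h => by simp only [κ, dif_neg h]
  have hκ : ∀ a b, Function.Injective a → Function.Injective b → (κ a = κ b ↔ Holds a b) := by
    intro a b ha hb
    by_cases h : ∃ s : Fin k → A, (∀ i, s i ∈ S) ∧ Holds a s <;>
    by_cases h' : ∃ s : Fin k → A, (∀ i, s i ∈ S) ∧ Holds b s
    · obtain ⟨s, hs, has⟩ := h
      obtain ⟨s', hs', hbs⟩ := h'
      rw [hκyes a s hs has, hκyes b s' hs' hbs, hcolS s s' hs hs'
        (injective_left_of_holds hA (hsymm _ _ has)) (injective_left_of_holds hA (hsymm _ _ hbs))]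
      exact ⟨fun e => htrans _ _ _ (htrans _ _ _ has e) (hsymm _ _ hbs),
        fun e => htrans _ _ _ (hsymm _ _ has) (htrans _ _ _ e hbs)⟩
    · refine iff_of_false (fun e => ?_) fun e => ?_
      · obtain ⟨s, hs, has⟩ := h
        rw [hκyes a s hs has, hκno b h'] at e
        have := hLS s hs
        omega
      · obtain ⟨s, hs, has⟩ := h
        exact h' ⟨s, hs, htrans _ _ _ (hsymm _ _ e) has⟩
    · refine iff_of_false (fun e => ?_) fun e => ?_
      · obtain ⟨s, hs, has⟩ := h'
        rw [hκyes b s hs has, hκno a h] at e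
        have := hLS s hs
        omega
      · obtain ⟨s, hs, has⟩ := h'
        exact h ⟨s, hs, htrans _ _ _ e has⟩
    · rw [hκno a h, hκno b h', Nat.add_left_cancel_iff, hcode, EquivK.holds_iff hA]
      simp [ha, hb]
  -- The new point `x` must give `insert x (tr a)` the colour `κ a`, for each tuple `a` through `m`.
  let tr : (Fin k → A) → Finset ℕ := fun a => ((Finset.univ.image a).erase m).image f
  let good : (Fin k → A) → Prop := fun a =>
    Function.Injective a ∧ (∀ i, a i ∈ insert m S) ∧ m ∈ Set.range a
  have htrF : ∀ a, good a → tr a ⊆ F := by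
    rintro a ⟨-, ha, -⟩ y hy
    simp only [tr, Finset.mem_image, Finset.mem_erase, Finset.mem_univ, true_and] at hy
    obtain ⟨_, ⟨hne, i, rfl⟩, rfl⟩ := hy
    exact hFmem _ ((ha i).resolve_left hne)
  have htr : ∀ a b, good a → good b → tr a = tr b → κ a = κ b := by
    intro a b ha hb h
    refine (hκ a b ha.1 hb.1).2 (holds_of_range_eq hA ha.1 hb.1 ?_)
    have hsub : ∀ a b, good a → good b → tr a = tr b → Set.range a ⊆ Set.range b := by
      rintro a b ⟨-, ha, -⟩ ⟨-, hb, hmb⟩ h _ ⟨i, rfl⟩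
      by_cases hi : a i = m
      · rwa [hi]
      · have : (f (a i) : ℕ) ∈ tr b := by
          rw [← h]
          exact Finset.mem_image_of_mem _ (by simp [hi])
        simp only [tr, Finset.mem_image, Finset.mem_erase, Finset.mem_univ, true_and] at this
        obtain ⟨_, ⟨hne, j, rfl⟩, e⟩ := this
        exact ⟨j, hf ((hb j).resolve_left hne) ((ha i).resolve_left hi) e⟩
    exact (hsub a b ha hb h).antisymm (hsub b a hb ha h.symm)
  let g : Finset ℕ →₀ ℕ := Finsupp.onFinset F.powerset
    (fun T => if h : ∃ a, good a ∧ tr a = T then κ h.choose else 0) (by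
      intro T hT
      by_cases h : ∃ a, good a ∧ tr a = T
      · obtain ⟨a, ha, rfl⟩ := h
        exact Finset.mem_powerset.2 (htrF a ha)
      · simp [h] at hT)
  have hg : ∀ a, good a → g (tr a) = κ a := by
    intro a ha
    have h : ∃ b, good b ∧ tr b = tr a := ⟨a, ha, rfl⟩
    simp only [g, Finsupp.onFinset_apply, dif_pos h]
    exact htr _ _ h.choose_spec.1 ha h.choose_spec.2
  obtain ⟨x, hx, hxT⟩ := exists_color_insert_eq (F.sup id) g
  have hFx : ∀ y ∈ F, y < x := fun y hy => lt_of_le_of_lt (Finset.le_sup (f := id) hy) hx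
  let f' : A → Generic k := Function.update f m x
  have hf'S : ∀ s ∈ S, f' s = f s := fun s hs =>
    Function.update_of_ne (ne_of_mem_of_not_mem hs hm) _ _
  have hf'm : f' m = x := Function.update_self _ _ _
  have hne : ∀ s ∈ S, f' s ≠ f' m := by
    intro s hs e
    rw [hf'S s hs, hf'm] at e
    exact (hFx _ (hFmem s hs)).ne e
  have hf'inj : Set.InjOn f' (insert m S) := by
    rintro s (rfl | hs) s' (rfl | hs') e
    · rfl
    · exact absurd e.symm (hne s' hs')
    · exact absurd e (hne s hs)
    · rw [hf'S s hs, hf'S s' hs'] at e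
      exact hf hs hs' e
  have hcol : ∀ a : Fin k → A, Function.Injective a → (∀ i, a i ∈ insert m S) →
      Generic.color (f' ∘ a) = κ a := by
    intro a hai ha
    by_cases hma : m ∈ Set.range a
    · have hgood : good a := ⟨hai, ha, hma⟩
      rw [← hg a hgood, ← hxT (tr a) fun y hy => hFx y (htrF a hgood hy), Generic.color]
      congr 1
      ext y
      simp only [tr, Finset.mem_image, Finset.mem_erase, Finset.mem_univ, true_and,
        Finset.mem_insert]
      constructor
      · rintro ⟨i, rfl⟩
        by_cases hi : a i = m
        · left
          rw [Function.comp, hi, hf'm]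
        · right
          exact ⟨a i, ⟨hi, i, rfl⟩, (hf'S _ ((ha i).resolve_left hi)).symm⟩
      · rintro (rfl | ⟨_, ⟨hi, i, rfl⟩, rfl⟩)
        · obtain ⟨i, hi⟩ := hma
          exact ⟨i, by rw [Function.comp, hi, hf'm]⟩
        · exact ⟨i, hf'S _ ((ha i).resolve_left hi)⟩
    · have haS : ∀ i, a i ∈ S := fun i => (ha i).resolve_left fun h => hma ⟨i, h⟩
      have : f' ∘ a = f ∘ a := funext fun i => hf'S _ (haS i)
      rw [this, hκyes a a haS ((hrefl a).2 hai)]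
  refine ⟨f', fun s hs => (hf'S s hs).symm, hf'inj, fun a b ha hb => ?_⟩
  have hi : ∀ a : Fin k → A, (∀ i, a i ∈ insert m S) →
      (Function.Injective (f' ∘ a) ↔ Function.Injective a) := fun a ha =>
    ⟨fun h => h.of_comp, fun h i j e => h (hf'inj (ha i) (ha j) e)⟩
  rw [Generic.holds_iff, hi a ha, hi b hb]
  constructor
  · rintro ⟨hai, hbi, h⟩
    rw [hcol a hai ha, hcol b hbi hb] at h
    exact (hκ a b hai hbi).1 h
  · intro h
    have hai := injective_left_of_holds hA h
    have hbi := injective_left_of_holds hA (hsymm _ _ h)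
    refine ⟨hai, hbi, ?_⟩
    rw [hcol a hai ha, hcol b hbi hb]
    exact (hκ a b hai hbi).2 h

end EquivK

/-! ### The independence property across universes -/

namespace HigherArity

open FirstOrder FirstOrder.Language

theorem FormulaIP.ulift {L : FirstOrder.Language.{u, v}} {T : L.Theory} {k m : ℕ} {d : Fin k → ℕ}
    {φ : L.Formula (Fin m ⊕ Σ t, Fin (d t))} (h : FormulaIP.{u, v, w'} k T φ) :
    FormulaIP.{u, v, max w' w} k T φ := by
  obtain ⟨M, b, hb⟩ := h
  let e : M ≃[L] Theory.ModelType.ulift.{u, v, w', w} M :=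
    Equiv.inducedStructureEquiv (Equiv.ulift.{w, w'} (α := M)).symm
  refine ⟨Theory.ModelType.ulift.{u, v, w', w} M, fun t i r => e (b t i r), fun X => ?_⟩
  obtain ⟨a, ha⟩ := hb X
  refine ⟨fun r => e (a r), fun i => ?_⟩
  rw [← ha i, ← StrongHomClass.realize_formula e]
  refine iff_of_eq (congrArg _ (funext fun p => ?_))
  rcases p with p | p <;> rfl

end HigherArity

/-! ### The generic model is a Fraïssé limit -/

namespace EquivK

open FirstOrder FirstOrder.Language

theorem isExtensionPair_generic {k : ℕ} {A : Type*} [Countable A] [(lang k).Structure A]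
    (hA : A ⊨ theory₀ k) : (lang k).IsExtensionPair A (Generic k) := by
  classical
  rw [isExtensionPair_iff_exists_embedding_closure_singleton_sup]
  intro S hS f m
  have hSfin : (S : Set A).Finite := hS.finite
  let F : A → Generic k := fun a => if h : a ∈ S then f ⟨a, h⟩ else 0
  have hF : ∀ s : S, F s = f s := fun s => by simp [F]
  have hFinj : Set.InjOn F S := fun s hs s' hs' e => by
    rw [hF ⟨s, hs⟩, hF ⟨s', hs'⟩] at e
    exact congrArg Subtype.val (f.injective e)
  have hFE : ∀ a b : Fin k → A, (∀ i, a i ∈ (S : Set A)) → (∀ i, b i ∈ (S : Set A)) →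
      (Holds (F ∘ a) (F ∘ b) ↔ Holds a b) := by
    intro a b ha hb
    have h1 := holds_comp_embedding f (fun i => ⟨a i, ha i⟩) (fun i => ⟨b i, hb i⟩)
    have h2 := holds_comp_embedding S.subtype (fun i => ⟨a i, ha i⟩) (fun i => ⟨b i, hb i⟩)
    have e : ∀ (a : Fin k → A) (ha : ∀ i, a i ∈ (S : Set A)),
        F ∘ a = f ∘ fun i => ⟨a i, ha i⟩ := fun a ha => funext fun i => hF ⟨a i, ha i⟩
    rw [e a ha, e b hb, h1, ← h2]
    rfl
  obtain ⟨F', hFF', hinj, hE⟩ : ∃ F' : A → Generic k, Set.EqOn F F' S ∧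
      Set.InjOn F' (insert m (S : Set A)) ∧
      ∀ a b : Fin k → A, (∀ i, a i ∈ insert m (S : Set A)) → (∀ i, b i ∈ insert m (S : Set A)) →
      (Holds (F' ∘ a) (F' ∘ b) ↔ Holds a b) := by
    by_cases hm : m ∈ (S : Set A)
    · rw [Set.insert_eq_of_mem hm]
      exact ⟨F, fun _ _ => rfl, hFinj, hFE⟩
    · exact exists_extend hA S hSfin F hFinj hFE m hm
  have hle : ∀ x ∈ (Substructure.closure (lang k) {m} ⊔ S : (lang k).Substructure A),
      x ∈ insert m (S : Set A) := by
    let T : (lang k).Substructure A := ⟨insert m (S : Set A), fun f => isEmptyElim f⟩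
    have : Substructure.closure (lang k) {m} ⊔ S ≤ T :=
      sup_le (Substructure.closure_le.2 (Set.singleton_subset_iff.2 (Set.mem_insert m _)))
        (Set.subset_insert _ _)
    exact fun x hx => this hx
  obtain ⟨g, hg⟩ := exists_embedding_of_holds_iff
    (Substructure.closure (lang k) {m} ⊔ S : (lang k).Substructure A) F'
    (hinj.mono hle) fun a b ha hb => hE a b (fun i => hle _ (ha i)) fun i => hle _ (hb i)
  refine ⟨g, Embedding.ext fun s => ?_⟩
  rw [Embedding.comp_apply, hg, ← hF s]
  exact hFF' s.2

theorem model_of_embedding {k : ℕ} {A B : Type*} [(lang k).Structure A] [(lang k).Structure B]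
    (g : A ↪[lang k] B) (hB : B ⊨ theory₀ k) : A ⊨ theory₀ k := by
  obtain ⟨h1, h2, h3, h4⟩ := model_theory₀_iff.1 hB
  refine model_theory₀_iff.2 ⟨fun a b => ?_, fun a b c => ?_, fun a => ?_, fun σ a ha => ?_⟩
  · simp only [← holds_comp_embedding g]
    exact h1 _ _
  · simp only [← holds_comp_embedding g]
    exact h2 _ _ _
  · rw [← holds_comp_embedding g, h3]
    exact g.injective.of_comp_iff a
  · rw [← holds_comp_embedding g]
    exact h4 σ (g ∘ a) (g.injective.comp ha)

theorem isFraisseLimit_generic {k : ℕ} (hk : 0 < k) :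
    IsFraisseLimit (finiteModels k) (Generic k) where
  ultrahomogeneous := (isUltrahomogeneous_iff_IsExtensionPair Structure.cg_of_countable).2
    (isExtensionPair_generic (Generic.model k))
  age := by
    ext A
    constructor
    · rintro ⟨hfg, ⟨g⟩⟩
      exact ⟨hfg.finite, model_of_embedding g (Generic.model k)⟩
    · rintro ⟨hfin, hA⟩
      have : IsEmpty ((lang k).Constants) := inferInstanceAs (IsEmpty Empty)
      have : IsEmpty ((lang k).Relations 0) := ⟨fun r => by
        have : ∀ n, Rel k n → 0 < n := fun n r => by cases r; omega
        exact (this 0 r).false⟩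
      obtain ⟨g, -⟩ := embedding_from_cg (M := A) Structure.cg_of_countable default
        (isExtensionPair_generic hA)
      exact ⟨Structure.FG.of_finite, ⟨g⟩⟩

theorem theory_eq_completeTheory_generic {k : ℕ} (hk : 0 < k) :
    theory k = (lang k).completeTheory (Generic k) :=
  theory_eq_completeTheory _ (isFraisseLimit_generic hk)

theorem theory₀_subset_theory {k : ℕ} (hk : 0 < k) : theory₀ k ⊆ theory k := by
  rw [theory_eq_completeTheory_generic hk]
  exact fun φ hφ => (Generic.model k).realize_of_mem φ hφ

/-! ### Formulas are determined by atomic types -/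

theorem realize_iff_of_same_atoms_generic {k : ℕ} (hk : 0 < k) {α : Type} [Finite α]
    (φ : (lang k).Formula α) (v v' : α → Generic k) (heq : ∀ p q, v p = v q ↔ v' p = v' q)
    (hE : ∀ x y : Fin k → α, Holds (fun i => v (x i)) (fun i => v (y i)) ↔
      Holds (fun i => v' (x i)) (fun i => v' (y i))) : φ.Realize v ↔ φ.Realize v' := by
  have hfac : Function.FactorsThrough v' v := fun p q h => (heq p q).1 h
  let F : Generic k → Generic k := Function.extend v v' id
  have hF : ∀ p, F (v p) = v' p := fun p => hfac.extend_apply id p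
  let S : (lang k).Substructure (Generic k) := Substructure.closure (lang k) (Set.range v)
  have hS : ∀ s ∈ S, ∃ p, v p = s := fun s hs =>
    by
    rwa [Substructure.mem_closure_iff_of_isRelational] at hs
  obtain ⟨f, hf⟩ := exists_embedding_of_holds_iff S F (by
    intro s hs s' hs' e
    obtain ⟨p, rfl⟩ := hS s hs
    obtain ⟨q, rfl⟩ := hS s' hs'
    rw [hF, hF] at e
    exact (heq p q).2 e) (by
    intro a b ha hb
    choose x hx using fun i => hS _ (ha i)
    choose y hy using fun i => hS _ (hb i)
    obtain rfl : (fun i => v (x i)) = a := funext hx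
    obtain rfl : (fun i => v (y i)) = b := funext hy
    rw [hE x y]
    have : ∀ x : Fin k → α, (F ∘ fun i => v (x i)) = fun i => v' (x i) :=
      fun x => funext fun i => hF (x i)
    rw [this, this])
  obtain ⟨g, hg⟩ := (isFraisseLimit_generic hk).ultrahomogeneous S
    (Substructure.fg_closure (Set.finite_range v)) f
  have : v' = g ∘ v := by
    funext p
    have hp : v p ∈ S := Substructure.subset_closure ⟨p, rfl⟩
    rw [← hF p, ← hf ⟨v p, hp⟩, hg]
    rfl
  rw [this, StrongHomClass.realize_formula]

/-- The sentence saying that any two tuples with the same atomic formulas agree on `φ`. -/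
noncomputable def atomsDetermine {k : ℕ} {α : Type} [Finite α] (φ : (lang k).Formula α) :
    (lang k).Sentence :=
  univ (β := α ⊕ α) (((Formula.iInf fun p : α × α =>
      (Term.equal (Term.var (Sum.inl p.1)) (Term.var (Sum.inl p.2))).iff
        (Term.equal (Term.var (Sum.inr p.1)) (Term.var (Sum.inr p.2)))) ⊓
    Formula.iInf fun p : (Fin k → α) × (Fin k → α) =>
      (eqv (fun i => Sum.inl (p.1 i)) (fun i => Sum.inl (p.2 i))).iff
        (eqv (fun i => Sum.inr (p.1 i)) (fun i => Sum.inr (p.2 i)))).imp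
    ((φ.relabel Sum.inl).iff (φ.relabel Sum.inr)))

theorem realize_atomsDetermine {k : ℕ} {α : Type} [Finite α] (φ : (lang k).Formula α) {M : Type w}
    [(lang k).Structure M] : M ⊨ atomsDetermine φ ↔ ∀ v v' : α → M,
      (∀ p q, v p = v q ↔ v' p = v' q) →
      (∀ x y : Fin k → α, Holds (fun i => v (x i)) (fun i => v (y i)) ↔
        Holds (fun i => v' (x i)) (fun i => v' (y i))) →
      (φ.Realize v ↔ φ.Realize v') := by
  simp only [atomsDetermine, realize_univ, Formula.realize_imp, Formula.realize_inf,
    Formula.realize_iInf, Formula.realize_iff, Formula.realize_equal, Term.realize_var,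
    realize_eqv, Formula.realize_relabel, and_imp, Prod.forall]
  exact ⟨fun h v v' => h (Sum.elim v v'), fun h v => h (v ∘ Sum.inl) (v ∘ Sum.inr)⟩

/-- In every model of `theory k`, the truth of a formula at a tuple depends only on the atomic
formulas true of that tuple. -/
theorem realize_iff_of_same_atoms {k : ℕ} (hk : 0 < k) {α : Type} [Finite α] {M : Type w}
    [(lang k).Structure M] (hM : M ⊨ theory k) (φ : (lang k).Formula α) (v v' : α → M)
    (heq : ∀ p q, v p = v q ↔ v' p = v' q)
    (hE : ∀ x y : Fin k → α, Holds (fun i => v (x i)) (fun i => v (y i)) ↔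
      Holds (fun i => v' (x i)) (fun i => v' (y i))) : φ.Realize v ↔ φ.Realize v' := by
  refine (realize_atomsDetermine φ).1 (hM.realize_of_mem _ ?_) v v' heq hE
  rw [theory_eq_completeTheory_generic hk]
  exact (realize_atomsDetermine φ).2 (realize_iff_of_same_atoms_generic hk φ)

/-! ### The functional order property fails -/

theorem nfop_theory {k : ℕ} (hk : 2 ≤ k) : HigherArity.NFOP.{0, 0, w} k (theory k) := by
  rintro m n d φ ⟨M, a, b, c, h⟩
  obtain ⟨l, rfl⟩ : ∃ l, k = l + 2 := ⟨k - 2, by omega⟩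
  have hk0 : 0 < l + 2 := by omega
  have hM : M ⊨ theory (l + 2) := M.is_model
  have hM₀ : M ⊨ theory₀ (l + 2) := hM.mono (theory₀_subset_theory hk0)
  let α := Fin m ⊕ (Σ t, Fin (d t)) ⊕ Fin n
  let V : ((Fin (l + 1) → ℕ) → ℕ) → (Fin (l + 1) → ℕ) → ℕ → α → M := fun f i j =>
    Sum.elim (a f) (Sum.elim (fun s => b s.1 (i s.1) s.2) (c j))
  -- The values are the tuples of entries and their `E`-classes.
  let val : ((Fin (l + 1) → ℕ) → ℕ) → (Fin (l + 1) → ℕ) → ℕ → Bool × (Fin (l + 2) → α) →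
      (Fin (l + 2) → M) ⊕ Set (Fin (l + 2) → M) := fun f i j x =>
    if x.1 then Sum.inr {y | Holds (V f i j ∘ x.2) y} else Sum.inl (V f i j ∘ x.2)
  -- A tuple of `l + 2` variables misses one of the `l + 3` blocks of variables.
  let block : α → Option (Option (Fin (l + 1))) :=
    Sum.elim (fun _ => none) (Sum.elim (fun s => some (some s.1)) fun _ => some none)
  have hmiss : ∀ x : Fin (l + 2) → α, ∃ o, ∀ r, block (x r) ≠ o := by
    intro x
    by_contra! hcon
    have := Fintype.card_le_of_surjective (fun r => block (x r)) hcon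
    simp at this
  have hcomp : ∀ f f' i i' j j', ∀ x : Fin (l + 2) → α,
      (∀ r, V f i j (x r) = V f' i' j' (x r)) → ∀ e, val f i j (e, x) = val f' i' j' (e, x) := by
    intro f f' i i' j j' x hx e
    have : V f i j ∘ x = V f' i' j' ∘ x := funext hx
    simp only [val, this]
  obtain ⟨f, i, j, j', hj, hj', hsame⟩ := HigherArity.exists_same_equalities val (by
    rintro ⟨e, x⟩
    obtain ⟨o, ho⟩ := hmiss x
    rcases o with _ | _ | t
    · refine Or.inl fun f f' i j => hcomp _ _ _ _ _ _ x (fun r => ?_) e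
      rcases hx : x r with p | p | p
      · exact absurd (by rw [hx]; rfl) (ho r)
      · rfl
      · rfl
    · refine Or.inr (Or.inl fun f i j j' => hcomp _ _ _ _ _ _ x (fun r => ?_) e)
      rcases hx : x r with p | p | p
      · rfl
      · rfl
      · exact absurd (by rw [hx]; rfl) (ho r)
    · refine Or.inr (Or.inr ⟨t, fun f i i' j hi => hcomp _ _ _ _ _ _ x (fun r => ?_) e⟩)
      rcases hx : x r with p | p | p
      · rfl
      · have : p.1 ≠ t := fun e => ho r (by rw [hx, ← e]; rfl)
        change b p.1 (i p.1) p.2 = b p.1 (i' p.1) p.2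
        rw [hi _ this]
      · rfl)
  -- Equality of two entries is equality of two constant tuples.
  have heq : ∀ p q, V f i j p = V f i j q ↔ V f i j' p = V f i j' q := by
    intro p q
    have := hsame (false, fun _ => p) (false, fun _ => q)
    simpa [val, funext_iff] using this
  have hreal : φ.Realize (V f i j) ↔ φ.Realize (V f i j') := by
    refine realize_iff_of_same_atoms hk0 hM φ _ _ heq fun x y => ?_
    rw [holds_iff hM₀, holds_iff hM₀]
    have hinj : ∀ x : Fin (l + 2) → α, (Function.Injective fun r => V f i j (x r)) ↔
        Function.Injective fun r => V f i j' (x r) := fun x =>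
      forall_congr' fun r => forall_congr' fun r' => imp_congr_left (heq _ _)
    have hcl := hsame (true, x) (true, y)
    simp only [val, if_true, Sum.inr.injEq] at hcl
    exact and_congr (hinj x) (and_congr (hinj y) hcl)
  have h1 := (h f i j).2 hj
  exact absurd ((h f i j').1 (hreal.1 h1)) (not_le.2 hj')

/-! ### The independence property holds -/

/-- Finite approximations of the independence property in the generic model: the elements
`Nat.pair t i` serve as the `i`-th member of the `t`-th sequence. -/
theorem exists_color_iff {n : ℕ} (c₀ N : ℕ) (X : Set (Fin n → ℕ)) :
    ∃ x, (∀ (t : Fin n), ∀ i < N, Nat.pair t i < x) ∧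
      ∀ i : Fin n → ℕ, (∀ t, i t < N) →
      (color (insert x (Finset.univ.image fun t : Fin n => Nat.pair t (i t))) = c₀ ↔ i ∈ X) := by
  classical
  let B : (Fin n → ℕ) → Finset ℕ := fun i => Finset.univ.image fun t : Fin n => Nat.pair t (i t)
  have hB : ∀ i i', B i = B i' → i = i' := by
    intro i i' h
    funext t
    have : Nat.pair t (i t) ∈ B i' := h ▸ Finset.mem_image_of_mem _ (Finset.mem_univ t)
    obtain ⟨s, -, hs⟩ := Finset.mem_image.1 this
    obtain ⟨h1, h2⟩ := Nat.pair_eq_pair.1 hs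
    obtain rfl := Fin.ext h1
    exact h2.symm
  let fam : Finset (Finset ℕ) := (Fintype.piFinset fun _ : Fin n => Finset.range N).image B
  let g : Finset ℕ →₀ ℕ := Finsupp.onFinset fam
    (fun T => if T ∈ fam then if ∃ i ∈ X, B i = T then c₀ else c₀ + 1 else 0) (by
      intro T hT
      by_contra h
      simp [h] at hT)
  obtain ⟨x, hx, hxT⟩ := exists_color_insert_eq
    ((Finset.univ ×ˢ Finset.range N : Finset (Fin n × ℕ)).sup fun p => Nat.pair p.1 p.2) g
  have hlt : ∀ (t : Fin n), ∀ i < N, Nat.pair t i < x := by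
    intro t i hi
    have := Finset.le_sup (f := fun p : Fin n × ℕ => Nat.pair p.1 p.2)
      (s := Finset.univ ×ˢ Finset.range N) (b := (t, i)) (by simp [hi])
    simp only at this
    omega
  refine ⟨x, hlt, fun i hi => ?_⟩
  change color (insert x (B i)) = c₀ ↔ _
  rw [hxT (B i) (by
    intro y hy
    obtain ⟨t, -, rfl⟩ := Finset.mem_image.1 hy
    exact hlt t _ (hi t))]
  have hmem : B i ∈ fam := Finset.mem_image_of_mem _ (by simpa using hi)
  have hX : (∃ i' ∈ X, B i' = B i) ↔ i ∈ X :=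
    ⟨fun ⟨i', h, e⟩ => hB _ _ e ▸ h, fun h => ⟨i, h, rfl⟩⟩
  simp only [g, Finsupp.onFinset_apply, if_pos hmem, hX]
  split_ifs with h <;> simp [h]

theorem hasIP_theory {n : ℕ} : HigherArity.HasIP.{0, 0, w} (n + 1) (theory (n + 2)) := by
  classical
  let φ : (lang (n + 2)).Formula (Fin (n + 3) ⊕ Σ _ : Fin (n + 1), Fin 1) :=
    eqv (Fin.cons (Sum.inl 0) fun t : Fin (n + 1) => Sum.inr ⟨t, 0⟩) fun i => Sum.inl i.succ
  let z : Fin (n + 2) → Generic (n + 2) := fun i => (i : ℕ)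
  have happrox : ∀ (X : Set (Fin (n + 1) → ℕ)) (N : ℕ), ∃ x : Generic (n + 2),
      ∀ i : Fin (n + 1) → ℕ, (∀ t, i t < N) →
      (φ.Realize (Sum.elim (Fin.cons x z : Fin (n + 3) → Generic (n + 2))
        fun s => Nat.pair s.1 (i s.1)) ↔ i ∈ X) := by
    intro X N
    obtain ⟨x, hlt, hx⟩ := exists_color_iff (Generic.color z) N X
    refine ⟨x, fun i hi => ?_⟩
    have e : (fun r => Sum.elim (Fin.cons x z : Fin (n + 3) → Generic (n + 2))
        (fun s : Σ _ : Fin (n + 1), Fin 1 => Nat.pair s.1 (i s.1))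
        ((Fin.cons (Sum.inl 0) fun t : Fin (n + 1) => Sum.inr ⟨t, 0⟩ :
          Fin (n + 2) → Fin (n + 3) ⊕ Σ _ : Fin (n + 1), Fin 1) r)) =
        (Fin.cons x fun t : Fin (n + 1) => Nat.pair t (i t) : Fin (n + 2) → Generic (n + 2)) := by
      funext r
      refine Fin.cases ?_ (fun t => ?_) r <;> simp
    rw [realize_eqv, e, Generic.holds_iff, ← hx i hi]
    have hinj : Function.Injective
        (Fin.cons x fun t : Fin (n + 1) => Nat.pair t (i t) : Fin (n + 2) → Generic (n + 2)) := by
      refine Fin.cons_injective_iff.2 ⟨?_, fun t t' h => Fin.ext (Nat.pair_eq_pair.1 h).1⟩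
      rintro ⟨t, ht⟩
      exact (hlt t _ (hi t)).ne ht
    have hz : Function.Injective z := Fin.val_injective
    have hc : Generic.color
        (Fin.cons x fun t : Fin (n + 1) => Nat.pair t (i t) : Fin (n + 2) → Generic (n + 2)) =
        color (insert x (Finset.univ.image fun t : Fin (n + 1) => Nat.pair t (i t))) := by
      refine congrArg color (Finset.ext fun y => ?_)
      simp [Fin.exists_fin_succ, eq_comm]
    have hz' : (fun r => Sum.elim (Fin.cons x z : Fin (n + 3) → Generic (n + 2))
        (fun s : Σ _ : Fin (n + 1), Fin 1 => Nat.pair s.1 (i s.1)) (Sum.inl r.succ)) = z := by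
      funext r
      simp
    rw [hz', hc]
    simp [hinj, hz]
  choose x hx using happrox
  let U := Filter.hyperfilter ℕ
  let M₀ : Type := (U : Filter ℕ).Product fun _ => Generic (n + 2)
  have hM₀ : M₀ ⊨ theory (n + 2) := by
    rw [theory_eq_completeTheory_generic (by omega)]
    exact ⟨fun ψ hψ => (Ultraproduct.sentence_realize ψ).2 (Filter.Eventually.of_forall fun _ => hψ)⟩
  refine ⟨n + 3, fun _ => 1, φ, HigherArity.FormulaIP.ulift
    ⟨Theory.ModelType.of (theory (n + 2)) M₀,
      fun t i _ => ((fun _ => Nat.pair t i : ℕ → Generic (n + 2)) : M₀), fun X =>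
      ⟨fun r => ((fun N => (Fin.cons (x X N) z : Fin (n + 3) → Generic (n + 2)) r) : M₀),
        fun i => ?_⟩⟩⟩
  have hlarge : ∀ᶠ N in (U : Filter ℕ), ∀ t, i t < N :=
    (Filter.eventually_all.2 fun t => Filter.eventually_gt_atTop (i t)).filter_mono
      Nat.hyperfilter_le_atTop
  have hcast := Ultraproduct.realize_formula_cast (u := U) (M := fun _ => Generic (n + 2)) φ
    (Sum.elim (fun r N => (Fin.cons (x X N) z : Fin (n + 3) → Generic (n + 2)) r)
      fun s _ => Nat.pair s.1 (i s.1))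
  have hiff : (∀ᶠ N in (U : Filter ℕ), φ.Realize (Sum.elim
      (Fin.cons (x X N) z : Fin (n + 3) → Generic (n + 2)) fun s => Nat.pair s.1 (i s.1))) ↔
      i ∈ X :=
    (Filter.eventually_congr (hlarge.mono fun N hN => hx X N i hN)).trans
      Filter.eventually_const
  have hval : ∀ N, (fun p => Sum.elim (fun r N => (Fin.cons (x X N) z : Fin (n + 3) →
      Generic (n + 2)) r) (fun (s : Σ _ : Fin (n + 1), Fin 1) _ => Nat.pair s.1 (i s.1)) p N) =
      Sum.elim (Fin.cons (x X N) z : Fin (n + 3) → Generic (n + 2))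
        fun s => Nat.pair s.1 (i s.1) := by
    refine fun N => funext fun p => ?_
    rcases p with p | p <;> rfl
  simp only [hval] at hcast
  refine (iff_of_eq (congrArg (Formula.Realize (M := M₀) φ) (funext fun p => ?_))).trans
    (hcast.trans hiff)
  rcases p with p | p <;> rfl

end EquivK

theorem mainTheorem5 (k : ℕ) (hk : 2 ≤ k) :
    HigherArity.NFOP.{0, 0, w} k (EquivK.theory k) ∧
      HigherArity.HasIP.{0, 0, w} (k - 1) (EquivK.theory k) := by
  obtain ⟨n, rfl⟩ : ∃ n, k = n + 2 := ⟨k - 2, by omega⟩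
  exact ⟨EquivK.nfop_theory hk, EquivK.hasIP_theory⟩
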